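/- Let $K$ be a field of characteristic $0$, let $R$ be an associative unital $K$-algebra (for example a PI-algebra), and let $F(R)=K\langle y_1,\dots,y_n\rangle/T(R)$ be the relatively free algebra of rank $n$ of $R$, where $T(R)$ is the ideal of all $f$ with $f(r_1,\dots,r_n)=0$ for all $r_1,\dots,r_n\in R$. Let $KY\subset F(R)$ be the span of the generators $y_1,\dots,y_n$. Let $\delta$ be a Weitzenböck derivation of $F(R)$, i.e. a $K$-linear map $\delta:F(R)\to F(R)$ with $\delta(uv)=\delta(u)v+u\delta(v)$ which is locally nilpotent and satisfies $\delta(KY)\subseteq KY$, and suppose that the Jordan normal form of $\delta$ on $KY$ consists of $k$ cells of sizes $d_1+1,\dots,d_k+1$ (with eigenvalue $0$). Identify the vector space $KY$, by any linear isomorphism, with the $GL_2(K)$-module \[ W=W(d_1)\oplus\cdots\oplus W(d_k), \] where $W(m)$ is the module of homogeneous polynomials of degree $m$ in two variables with the natural action of $GL_2(K)$ by linear substitutions, and extend the resulting action of $GL_2(K)$ on $KY$ diagonally to an action on $F(R)$ by algebra automorphisms. Let $F(R)^\delta=\ker\delta$ be the algebra of constants of $\delta$ and let $F(R)^{UT_2}$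 be the algebra of invariants of the subgroup $UT_2\subset GL_2(K)$ of upper unitriangular matrices. Then \[ H(F(R)^\delta;t)=H(F(R)^{UT_2};t), \] where $H(A;t)=\sum_{m\ge 0}\dim_K\bigl(A\cap F(R)^{(m)}\bigr)t^m$ and $F(R)^{(m)}$ is the span of the products of $m$ generators. -/

import Mathlib

open scoped DirectSum PowerSeries

noncomputable section

namespace RelFree

section Algebra

variable (K : Type*) [Field K] (R : Type*) [Ring R] [Algebra K R] (n : ℕ)

/-- The T-ideal `T(R)` in `n` variables: all elements `f(y_1, …, y_n)` of the free associative
unital algebra `K⟨y_1, …, y_n⟩` such that `f(r_1, …, r_n) = 0` for all `r_1, …, r_n ∈ R`. -/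
def tIdeal : Ideal (FreeAlgebra K (Fin n)) where
  carrier := {f | ∀ r : Fin n → R, FreeAlgebra.lift K r f = 0}
  add_mem' := fun {a b} ha hb r => by rw [map_add, ha r, hb r, add_zero]
  zero_mem' := fun r => map_zero _
  smul_mem' := fun c f hf r => by rw [smul_eq_mul, map_mul, hf r, mul_zero]

instance : (tIdeal K R n).IsTwoSided :=
  ⟨fun {a} b ha r => by rw [map_mul, show FreeAlgebra.lift K r a = 0 from ha r, zero_mul]⟩

/-- The relatively free algebra `F(R) = K⟨y_1, …, y_n⟩ / T(R)` of rank `n`. -/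
abbrev RelFreeAlg : Type _ := FreeAlgebra K (Fin n) ⧸ tIdeal K R n

/-- The free generators `y_1, …, y_n` of `F(R)`. -/
def gen (i : Fin n) : RelFreeAlg K R n :=
  Ideal.Quotient.mkₐ K (tIdeal K R n) (FreeAlgebra.ι K i)

/-- The vector space `KY` spanned by the free generators of `F(R)`. -/
def genSpan : Submodule K (RelFreeAlg K R n) :=
  Submodule.span K (Set.range (gen K R n))

/-- The homogeneous component of degree `m` of `F(R)`: the span of all products of `m`
generators. -/
def homogComponent (m : ℕ) : Submodule K (RelFreeAlg K R n) :=
  Submodule.span K (Set.range fun w : Fin m → Fin n => (List.ofFn fun j => gen K R n (w j)).prod)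

/-- So the dimensions that enter a Hilbert series are genuine natural numbers. -/
instance finite_homogComponent (m : ℕ) : Module.Finite K (homogComponent K R n m) :=
  Module.Finite.span_of_finite K (Set.finite_range _)

variable {K R n}

/-- The Hilbert series `∑ₘ dim (A ∩ F(R)⁽ᵐ⁾) tᵐ` of a subalgebra `A` of `F(R)`. -/
def hilbertSeries (A : Subalgebra K (RelFreeAlg K R n)) : ℤ⟦X⟧ :=
  PowerSeries.mk fun m =>
    (Module.finrank K ↥(Subalgebra.toSubmodule A ⊓ homogComponent K R n m) : ℤ)

theorem exists_subst (f : Fin n → RelFreeAlg K R n) :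
    ∀ a ∈ tIdeal K R n, FreeAlgebra.lift K f a = 0 := by
  intro a ha
  choose g hg using fun i => Ideal.Quotient.mk_surjective (I := tIdeal K R n) (f i)
  have h1 : FreeAlgebra.lift K f =
      (Ideal.Quotient.mkₐ K (tIdeal K R n)).comp (FreeAlgebra.lift K g) := by
    ext i
    simp [hg]
  rw [h1, AlgHom.comp_apply, Ideal.Quotient.mkₐ_eq_mk, Ideal.Quotient.eq_zero_iff_mem]
  intro r
  have h2 : (FreeAlgebra.lift K r).comp (FreeAlgebra.lift K g) =
      FreeAlgebra.lift K (fun i => FreeAlgebra.lift K r (g i)) := by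
    ext i
    simp
  rw [← AlgHom.comp_apply, h2]
  exact ha _

/-- The endomorphism of `F(R)` with `y_i ↦ f_i`. -/
def subst (f : Fin n → RelFreeAlg K R n) : RelFreeAlg K R n →ₐ[K] RelFreeAlg K R n :=
  Ideal.Quotient.liftₐ (tIdeal K R n) (FreeAlgebra.lift K f) (exists_subst f)

theorem subst_gen (f : Fin n → RelFreeAlg K R n) (i : Fin n) :
    subst f (gen K R n i) = f i := by
  change FreeAlgebra.lift K f (FreeAlgebra.ι K i) = f i
  rw [FreeAlgebra.lift_ι_apply]

theorem gen_mem (i : Fin n) : gen K R n i ∈ genSpan K R n :=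
  Submodule.subset_span ⟨i, rfl⟩

theorem algHom_ext_gen {φ ψ : RelFreeAlg K R n →ₐ[K] RelFreeAlg K R n}
    (h : ∀ i, φ (gen K R n i) = ψ (gen K R n i)) : φ = ψ := by
  apply Ideal.Quotient.algHom_ext
  ext i
  exact h i

/-- The diagonal extension to `F(R)` of a linear operator on `KY`. -/
def diagExt (A : Module.End K (genSpan K R n)) : RelFreeAlg K R n →ₐ[K] RelFreeAlg K R n :=
  subst fun i => (A ⟨gen K R n i, gen_mem i⟩ : RelFreeAlg K R n)

theorem diagExt_apply (A : Module.End K (genSpan K R n)) (v : genSpan K R n) :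
    diagExt A v = A v := by
  obtain ⟨v, hv⟩ := v
  induction hv using Submodule.span_induction with
  | mem x hx =>
    obtain ⟨i, rfl⟩ := hx
    exact subst_gen _ i
  | zero =>
    have : (⟨0, Submodule.zero_mem _⟩ : genSpan K R n) = 0 := rfl
    rw [this, map_zero, Submodule.coe_zero, map_zero]
  | add x y hx hy h1 h2 =>
    have : (⟨x + y, Submodule.add_mem _ hx hy⟩ : genSpan K R n) = ⟨x, hx⟩ + ⟨y, hy⟩ := rfl
    rw [this, map_add, Submodule.coe_add, Submodule.coe_add, map_add, h1, h2]
  | smul a x hx h1 =>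
    have : (⟨a • x, Submodule.smul_mem _ a hx⟩ : genSpan K R n) = a • ⟨x, hx⟩ := rfl
    rw [this, map_smul, Submodule.coe_smul, Submodule.coe_smul, map_smul, h1]

/-- The action of a group on `F(R)` by algebra endomorphisms that extends diagonally a linear
action on `KY`. -/
def diagAction {G : Type*} [Group G] (ρ : Representation K G (genSpan K R n)) :
    G →* (RelFreeAlg K R n →ₐ[K] RelFreeAlg K R n) where
  toFun g := diagExt (ρ g)
  map_one' := algHom_ext_gen fun i => by
    rw [map_one]
    exact diagExt_apply 1 ⟨_, gen_mem i⟩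
  map_mul' g h := algHom_ext_gen fun i => by
    rw [map_mul, AlgHom.mul_apply]
    rw [diagExt_apply _ ⟨_, gen_mem i⟩, diagExt_apply _ ⟨_, gen_mem i⟩, diagExt_apply]
    rfl

/-- The algebra `F(R)^H` of invariants of a subgroup `H` of `G`, for an action of `G` on `F(R)`. -/
def invariants {G : Type*} [Group G] (α : G →* (RelFreeAlg K R n →ₐ[K] RelFreeAlg K R n))
    (H : Subgroup G) : Subalgebra K (RelFreeAlg K R n) where
  carrier := {f | ∀ g ∈ H, α g f = f}
  mul_mem' := fun {a b} ha hb g hg => by rw [map_mul, ha g hg, hb g hg]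
  add_mem' := fun {a b} ha hb g hg => by rw [map_add, ha g hg, hb g hg]
  algebraMap_mem' := fun c g _ => AlgHom.commutes _ c

variable (K R n) in
/-- A Weitzenböck derivation of `F(R)`: a locally nilpotent derivation which acts as a linear
operator on the span `KY` of the generators. -/
structure WeitzenbockDerivation where
  /-- the underlying linear operator -/
  toLin : RelFreeAlg K R n →ₗ[K] RelFreeAlg K R n
  leibniz : ∀ u v, toLin (u * v) = toLin u * v + u * toLin v
  linear : ∀ v ∈ genSpan K R n, toLin v ∈ genSpan K R n
  locallyNilpotent : ∀ u, ∃ p : ℕ, (toLin ^ p) u = 0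

namespace WeitzenbockDerivation

/-- The algebra of constants `F(R)^δ`, i.e. the kernel of `δ`. -/
def constants (δ : WeitzenbockDerivation K R n) : Subalgebra K (RelFreeAlg K R n) where
  carrier := {f | δ.toLin f = 0}
  mul_mem' := fun {a b} ha hb => by
    change δ.toLin (a * b) = 0
    rw [δ.leibniz, show δ.toLin a = 0 from ha, show δ.toLin b = 0 from hb, zero_mul, mul_zero,
      add_zero]
  add_mem' := fun {a b} ha hb => by
    change δ.toLin (a + b) = 0
    rw [map_add, show δ.toLin a = 0 from ha, show δ.toLin b = 0 from hb, add_zero]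
  algebraMap_mem' := fun c => by
    change δ.toLin _ = 0
    have h := δ.leibniz 1 1
    rw [mul_one, one_mul, mul_one, left_eq_add] at h
    rw [Algebra.algebraMap_eq_smul_one, map_smul, h, smul_zero]

/-- The Jordan normal form of `δ` on `KY` consists of `k` cells, of sizes
`d_1 + 1, …, d_k + 1` (all eigenvalues being `0`, as `δ` is locally nilpotent). -/
def HasJordanCells (δ : WeitzenbockDerivation K R n) {k : ℕ} (d : Fin k → ℕ) : Prop :=
  ∃ b : Module.Basis (Σ i : Fin k, Fin (d i + 1)) K (genSpan K R n),
    (∀ i, δ.toLin (b ⟨i, 0⟩) = 0) ∧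
      ∀ (i : Fin k) (j : Fin (d i)), δ.toLin (b ⟨i, j.succ⟩) = b ⟨i, j.castSucc⟩

end WeitzenbockDerivation

end Algebra

section GLTwo

variable (K : Type*) [Field K]

/-- The substitution `f ↦ f(g x)`, where `g x_j = ∑_i g_{ij} x_i`. -/
def linSubst (g : Matrix (Fin 2) (Fin 2) K) :
    MvPolynomial (Fin 2) K →ₐ[K] MvPolynomial (Fin 2) K :=
  MvPolynomial.aeval fun j => ∑ i, MvPolynomial.C (g i j) * MvPolynomial.X i

theorem linSubst_mem (g : Matrix (Fin 2) (Fin 2) K) {m : ℕ} (f : MvPolynomial (Fin 2) K)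
    (hf : f ∈ MvPolynomial.homogeneousSubmodule (Fin 2) K m) :
    linSubst K g f ∈ MvPolynomial.homogeneousSubmodule (Fin 2) K m := by
  rw [MvPolynomial.mem_homogeneousSubmodule] at hf ⊢
  have h := hf.aeval (n := 1) (fun j => ∑ i, MvPolynomial.C (g i j) * MvPolynomial.X i)
    (fun j => MvPolynomial.IsHomogeneous.sum _ _ _ fun i _ =>
      (MvPolynomial.isHomogeneous_X K i).C_mul _)
  rwa [one_mul] at h

/-- The irreducible polynomial `GL_2`-module `W(m)`: binary forms of degree `m`, on which `GL_2`
acts by linear substitutions of the variables. -/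
def formRep (m : ℕ) : Representation K (GL (Fin 2) K)
    (MvPolynomial.homogeneousSubmodule (Fin 2) K m) where
  toFun g := (linSubst K g).toLinearMap.restrict (linSubst_mem K g)
  map_one' := by
    have h : linSubst K ((1 : GL (Fin 2) K) : Matrix (Fin 2) (Fin 2) K) = AlgHom.id K _ := by
      ext j : 1
      simp [linSubst, Matrix.one_apply]
    ext1 f
    apply Subtype.ext
    exact DFunLike.congr_fun h (f : MvPolynomial (Fin 2) K)
  map_mul' g h := by
    have e : linSubst K ((g * h : GL (Fin 2) K) : Matrix (Fin 2) (Fin 2) K) =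
        (linSubst K g).comp (linSubst K h) := by
      ext j : 1
      simp [linSubst, Matrix.mul_apply]
      ring
    ext1 f
    apply Subtype.ext
    exact DFunLike.congr_fun e (f : MvPolynomial (Fin 2) K)

/-- The vector space of `W = W(d_1) ⊕ ⋯ ⊕ W(d_k)`. -/
abbrev FormSum {k : ℕ} (d : Fin k → ℕ) : Type _ :=
  ⨁ i, MvPolynomial.homogeneousSubmodule (Fin 2) K (d i)

/-- The `GL_2`-module `W = W(d_1) ⊕ ⋯ ⊕ W(d_k)`. -/
def formSumRep {k : ℕ} (d : Fin k → ℕ) : Representation K (GL (Fin 2) K) (FormSum K d) :=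
  Representation.directSum fun i => formRep K (d i)

/-- The unitriangular group `UT_2` inside `GL_2`. -/
def UT2 : Subgroup (GL (Fin 2) K) where
  carrier := {g | ∃ a : K, (g : Matrix (Fin 2) (Fin 2) K) = !![1, a; 0, 1]}
  one_mem' := ⟨0, by simp [Matrix.one_fin_two]⟩
  mul_mem' := by
    rintro g h ⟨a, ha⟩ ⟨b, hb⟩
    exact ⟨a + b, by simp [ha, hb, add_comm]⟩
  inv_mem' := by
    rintro g ⟨a, ha⟩
    refine ⟨-a, ?_⟩
    rw [Matrix.coe_units_inv, ha]
    exact Matrix.inv_eq_left_inv (by simp [Matrix.one_fin_two])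

end GLTwo

/-- Transport of a linear action along an identification `φ` of vector spaces. -/
def transport {K G V W : Type*} [Field K] [Group G] [AddCommMonoid V] [Module K V]
    [AddCommMonoid W] [Module K W] (φ : V ≃ₗ[K] W) (ρ : Representation K G W) :
    Representation K G V where
  toFun g := φ.symm.toLinearMap ∘ₗ ρ g ∘ₗ φ.toLinearMap
  map_one' := by
    ext v
    simp
  map_mul' g h := by
    ext v
    simp

end RelFree

end

open scoped DirectSum PowerSeries

noncomputable section

namespace RelFree

/-! ### Exponentials of locally nilpotent derivations. -/

section ExpLocallyNilpotent

variable {K A : Type*} [Field K] [Ring A] [Algebra K A]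

/-! In characteristic `0` a locally nilpotent derivation exponentiates to algebra automorphisms `exp
(a δ)`. Elements of `ker δ` are fixed by all of them, and an element fixed by `exp δ` alone already
lies in `ker δ` (`apply_eq_zero_of_expAlgHom_one_apply`).

On binary forms, the unitriangular matrix with entry `a` sends `x_1` to `a x_0 + x_1`, so it is the
exponential of `a x_0 ∂/∂x_1`. That operator shifts the divided forms `x_0 ^ (m - j) x_1 ^ j / j!`
down by one, exactly as `δ` shifts a Jordan cell. Hence the linear automorphism `e` of `KY` matching
a Jordan basis with the divided forms, read through `φ`, conjugates `exp (a δ)` to the action of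
that matrix. Both sides being algebra maps, this persists on all of `F(R)` (`diagAction_diagExt`).

The diagonal extension of `e` therefore maps the constants onto the invariants. It preserves degree,
so the Hilbert series agree (`hilbertSeries_eq_of_diagExt`). The choice of `φ` is harmless because
`e` absorbs it. -/

theorem pow_apply_eq_zero_of_le {D : A →ₗ[K] A} {u : A} {p q : ℕ} (h : (D ^ p) u = 0)
    (hpq : p ≤ q) : (D ^ q) u = 0 := by
  obtain ⟨r, rfl⟩ := Nat.exists_eq_add_of_le' hpq
  rw [pow_add, Module.End.mul_apply, h, map_zero]

theorem pow_apply_mul {D : A →ₗ[K] A} (hD : ∀ u v, D (u * v) = D u * v + u * D v)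
    (m : ℕ) (u v : A) :
    (D ^ m) (u * v) =
      ∑ ij ∈ Finset.HasAntidiagonal.antidiagonal m, m.choose ij.1 • ((D ^ ij.1) u * (D ^ ij.2) v) := by
  induction m with
  | zero => simp
  | succ m ih =>
    rw [Finset.sum_antidiagonal_choose_succ_nsmul (fun i j => (D ^ i) u * (D ^ j) v) m]
    rw [pow_succ', Module.End.mul_apply, ih, map_sum, ← Finset.sum_add_distrib]
    refine Finset.sum_congr rfl fun ij hij => ?_
    have e : m.choose ij.2 = m.choose ij.1 :=
      (Nat.choose_symm_of_eq_add (Finset.HasAntidiagonal.mem_antidiagonal.1 hij).symm).symm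
    rw [map_nsmul, hD, nsmul_add, pow_succ', Module.End.mul_apply, pow_succ', Module.End.mul_apply,
      e, add_comm]

/-- The truncation after `q` terms of the exponential series of `a • D`, applied to `u`. -/
def expPartial (D : A →ₗ[K] A) (a : K) (q : ℕ) (u : A) : A :=
  ∑ m ∈ Finset.range q, (a ^ m / m.factorial) • (D ^ m) u

theorem expPartial_eq_of_le {D : A →ₗ[K] A} {a : K} {u : A} {p q : ℕ} (h : (D ^ p) u = 0)
    (hpq : p ≤ q) : expPartial D a q u = expPartial D a p u := by
  refine (Finset.sum_subset (Finset.range_mono hpq) fun m _ hm => ?_).symm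
  rw [pow_apply_eq_zero_of_le h (by simpa using hm), smul_zero]

theorem expPartial_mul [CharZero K] {D : A →ₗ[K] A}
    (hD : ∀ u v, D (u * v) = D u * v + u * D v) {a : K} {u v : A} {p q : ℕ}
    (hu : (D ^ p) u = 0) (hv : (D ^ q) v = 0) :
    expPartial D a (p + q) (u * v) = expPartial D a p u * expPartial D a q v := by
  have key (m : ℕ) : (a ^ m / m.factorial) • (D ^ m) (u * v) =
      ∑ ij ∈ Finset.HasAntidiagonal.antidiagonal m, ((a ^ ij.1 / ij.1.factorial) • (D ^ ij.1) u) *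
        ((a ^ ij.2 / ij.2.factorial) • (D ^ ij.2) v) := by
    rw [pow_apply_mul hD, Finset.smul_sum]
    refine Finset.sum_congr rfl fun ij hij => ?_
    obtain ⟨i, j⟩ := ij
    obtain rfl : i + j = m := Finset.HasAntidiagonal.mem_antidiagonal.1 hij
    rw [← Nat.cast_smul_eq_nsmul K, smul_smul, smul_mul_smul_comm,
      Nat.cast_add_choose K]
    congr 1
    have := Nat.cast_ne_zero (R := K).2 (i + j).factorial_ne_zero
    field_simp
    ring
  unfold expPartial
  simp_rw [key]
  rw [Finset.sum_mul_sum, ← Finset.sum_product', Finset.sum_sigma']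
  symm
  -- The rectangle `i < p`, `j < q` embeds in the triangle `i + j < p + q`; in the rest of the
  -- triangle `p ≤ i` or `q ≤ j`, so those terms vanish.
  refine Finset.sum_of_injOn (fun ij => ⟨ij.1 + ij.2, ij⟩) ?_ ?_ ?_ ?_
  · rintro ⟨i, j⟩ _ ⟨i', j'⟩ _ h
    simp only [Sigma.mk.injEq] at h
    exact eq_of_heq h.2
  · rintro ⟨i, j⟩ h
    simp at h ⊢
    omega
  · rintro ⟨m, i, j⟩ h h'
    simp only [Finset.mem_sigma, Finset.mem_range, Finset.HasAntidiagonal.mem_antidiagonal] at h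
    obtain ⟨_, rfl⟩ := h
    by_cases hi : p ≤ i
    · rw [pow_apply_eq_zero_of_le hu hi, smul_zero, zero_mul]
    by_cases hj : q ≤ j
    · rw [pow_apply_eq_zero_of_le hv hj, smul_zero, mul_zero]
    refine absurd ⟨(i, j), ?_, rfl⟩ h'
    simp
    omega
  · intros
    rfl

theorem apply_one_of_leibniz {D : A →ₗ[K] A}
    (hD : ∀ u v, D (u * v) = D u * v + u * D v) : D 1 = 0 := by
  simpa using hD 1 1

/-- The automorphism `exp (a D)` defined by a locally nilpotent derivation `D`. -/
def expAlgHom [CharZero K] (D : A →ₗ[K] A) (hD : ∀ u v, D (u * v) = D u * v + u * D v)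
    (hn : ∀ u, ∃ p : ℕ, (D ^ p) u = 0) (a : K) : A →ₐ[K] A :=
  -- The value does not depend on which annihilating exponent is chosen, so several elements can be
  -- compared at a common truncation.
  have eq (u : A) (p : ℕ) (h : (D ^ p) u = 0) :
      expPartial D a (hn u).choose u = expPartial D a p u := by
    rcases le_total p (hn u).choose with hp | hp
    · exact expPartial_eq_of_le h hp
    · exact (expPartial_eq_of_le (hn u).choose_spec hp).symm
  have hc (c : K) : expPartial D a (hn (algebraMap K A c)).choose (algebraMap K A c) =
      algebraMap K A c := by
    rw [eq _ 1 (by rw [pow_one, Algebra.algebraMap_eq_smul_one, map_smul,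
      apply_one_of_leibniz hD, smul_zero])]
    simp [expPartial]
  { toFun u := expPartial D a (hn u).choose u
    map_one' := by simpa using hc 1
    map_zero' := by simpa using hc 0
    map_mul' u v := by
      rw [← expPartial_mul hD (hn u).choose_spec (hn v).choose_spec]
      refine eq _ _ ?_
      rw [pow_apply_mul hD]
      refine Finset.sum_eq_zero fun ij hij => ?_
      have hij' := Finset.HasAntidiagonal.mem_antidiagonal.1 hij
      by_cases hi : (hn u).choose ≤ ij.1
      · rw [pow_apply_eq_zero_of_le (hn u).choose_spec hi, zero_mul, smul_zero]
      · rw [pow_apply_eq_zero_of_le (hn v).choose_spec (q := ij.2) (by omega), mul_zero, smul_zero]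
    map_add' u v := by
      have hu := pow_apply_eq_zero_of_le (hn u).choose_spec (le_max_left _ (hn v).choose)
      have hv := pow_apply_eq_zero_of_le (hn v).choose_spec (le_max_right (hn u).choose _)
      rw [eq u _ hu, eq v _ hv, eq (u + v) _ (by rw [map_add, hu, hv, add_zero])]
      simp [expPartial, Finset.sum_add_distrib]
    commutes' := hc }

theorem expAlgHom_apply [CharZero K] {D : A →ₗ[K] A}
    (hD : ∀ u v, D (u * v) = D u * v + u * D v)
    (hn : ∀ u, ∃ p : ℕ, (D ^ p) u = 0) (a : K) {u : A} {p : ℕ} (h : (D ^ p) u = 0) :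
    expAlgHom D hD hn a u = ∑ m ∈ Finset.range p, (a ^ m / m.factorial) • (D ^ m) u := by
  change expPartial D a (hn u).choose u = expPartial D a p u
  rcases le_total p (hn u).choose with hp | hp
  · exact expPartial_eq_of_le h hp
  · exact (expPartial_eq_of_le (hn u).choose_spec hp).symm

theorem expAlgHom_apply_of_apply_eq_zero [CharZero K] {D : A →ₗ[K] A}
    (hD : ∀ u v, D (u * v) = D u * v + u * D v)
    (hn : ∀ u, ∃ p : ℕ, (D ^ p) u = 0) (a : K) {u : A} (h : D u = 0) :
    expAlgHom D hD hn a u = u := by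
  rw [expAlgHom_apply hD hn a (p := 1) (by rwa [pow_one])]
  simp

/-- Descent on the exponent that kills `u`: if `D ^ (p + 2)` does, apply `D ^ p` to `exp D u - u =
0`. Every term of order at least `2` dies and only `D ^ (p + 1) u = 0` is left. -/
theorem apply_eq_zero_of_expAlgHom_one_apply [CharZero K] {D : A →ₗ[K] A}
    (hD : ∀ u v, D (u * v) = D u * v + u * D v)
    (hn : ∀ u, ∃ p : ℕ, (D ^ p) u = 0) {u : A} (h : expAlgHom D hD hn 1 u = u) :
    D u = 0 := by
  obtain ⟨p, hp⟩ := hn u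
  induction p with
  | zero => rw [show u = 0 from hp, map_zero]
  | succ p ih =>
    obtain _ | p := p
    · simpa using hp
    refine ih ?_
    rw [expAlgHom_apply hD hn 1 hp, Finset.sum_range_succ'] at h
    simp only [pow_zero, Nat.factorial_zero, Nat.cast_one, div_one, one_smul,
      Module.End.one_apply, add_eq_right] at h
    have h2 := congrArg (D ^ p) h
    rw [map_zero, map_sum, Finset.sum_range_succ', Finset.sum_eq_zero] at h2
    · simpa [pow_succ, ← Module.End.mul_apply] using h2
    · intro m _
      rw [map_smul, ← Module.End.mul_apply, ← pow_add,
        pow_apply_eq_zero_of_le hp (by omega), smul_zero]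

end ExpLocallyNilpotent

/-! ### Matching a basis with an independent family. -/

section LinearAlgebra

theorem linearIndependent_lof {ι K : Type*} [DecidableEq ι] [Semiring K] {V : ι → Type*}
    [∀ i, AddCommMonoid (V i)] [∀ i, Module K (V i)] {η : ι → Type*} (f : ∀ i, η i → V i)
    (hf : ∀ i, LinearIndependent K (f i)) :
    LinearIndependent K fun x : Σ i, η i => DirectSum.lof K ι V x.1 (f x.1 x.2) :=
  DFinsupp.linearIndependent_single f hf

/-- An injective endomorphism of a finite-dimensional space is bijective, so independence of `w`
suffices and spanning need not be checked. -/
theorem exists_equiv_apply_basis {ι K V W : Type*} [Field K] [AddCommGroup V] [Module K V]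
    [AddCommMonoid W] [Module K W] [Finite ι] (φ : V ≃ₗ[K] W) (b : Module.Basis ι K V)
    {w : ι → W} (hw : LinearIndependent K w) :
    ∃ e : V ≃ₗ[K] V, ∀ x, e (b x) = φ.symm (w x) := by
  have : Module.Finite K V := Module.Finite.of_basis b
  refine ⟨LinearEquiv.ofInjectiveEndo (φ.symm.toLinearMap ∘ₗ b.constr K w) ?_, fun x => ?_⟩
  · rw [LinearMap.coe_comp]
    refine φ.symm.injective.comp ?_
    intro v v' h
    rw [b.constr_apply, b.constr_apply] at h
    exact b.repr.injective (hw h)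
  · simp

end LinearAlgebra

/-! ### The unitriangular action on divided binary forms. -/

section Forms

variable (K : Type*) [Field K]

/-- The form `x_0 ^ (m - j) * x_1 ^ j / j!` of degree `m`. -/
def dividedForm (m : ℕ) (j : Fin (m + 1)) : MvPolynomial.homogeneousSubmodule (Fin 2) K m :=
  ⟨((j : ℕ).factorial : K)⁻¹ •
      (MvPolynomial.X 0 ^ (m - (j : ℕ)) * MvPolynomial.X 1 ^ (j : ℕ)), by
    refine Submodule.smul_mem _ _ ?_
    rw [MvPolynomial.mem_homogeneousSubmodule]
    have := (MvPolynomial.isHomogeneous_X_pow (R := K) (0 : Fin 2) (m - (j : ℕ))).mul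
      (MvPolynomial.isHomogeneous_X_pow (R := K) (1 : Fin 2) (j : ℕ))
    rwa [Nat.sub_add_cancel (Nat.lt_succ_iff.1 j.2)] at this⟩

theorem linearIndependent_dividedForm [CharZero K] (m : ℕ) :
    LinearIndependent K (dividedForm K m) := by
  refine LinearIndependent.of_comp (Submodule.subtype _) ?_
  let s : Fin (m + 1) → (Fin 2 →₀ ℕ) := fun j =>
    Finsupp.single 0 (m - (j : ℕ)) + Finsupp.single 1 (j : ℕ)
  have hs : Function.Injective s := fun i j h => by
    have := DFunLike.congr_fun h 1
    -- The exponent of `x_1` recovers `j`, so the forms are nonzero multiples of distinct monomials.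
    simpa [s, Fin.ext_iff] using this
  have h1 := (MvPolynomial.basisMonomials (Fin 2) K).linearIndependent.comp s hs
  have h2 := h1.units_smul fun j => (Units.mk0 (((j : ℕ).factorial : K)⁻¹)
    (inv_ne_zero (Nat.cast_ne_zero.2 (j : ℕ).factorial_ne_zero)))
  refine Eq.subst (motive := fun f => LinearIndependent K f) (funext fun j => ?_) h2
  simp [dividedForm, s, Units.smul_def, MvPolynomial.X_pow_eq_monomial, MvPolynomial.monomial_mul]

/-- Binomial expansion of `(a x_0 + x_1) ^ j`: dividing by `j!` turns `j.choose l` into `1 / (l! (j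
- l)!)`, which leaves the coefficients of an exponential series. -/
theorem formRep_dividedForm [CharZero K] {g : GL (Fin 2) K} {a : K}
    (hg : (g : Matrix (Fin 2) (Fin 2) K) = !![1, a; 0, 1]) (m : ℕ) (j : Fin (m + 1)) :
    formRep K m g (dividedForm K m j) =
      ∑ l ∈ Finset.range (j + 1), (a ^ l / l.factorial) •
        dividedForm K m ⟨j - l, (Nat.sub_le _ _).trans_lt j.2⟩ := by
  apply Subtype.ext
  change linSubst K g (dividedForm K m j : MvPolynomial (Fin 2) K) = _
  rw [AddSubmonoidClass.coe_finsetSum, hg]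
  simp only [dividedForm, map_smul, map_mul, map_pow, Submodule.coe_smul]
  have h0 : linSubst K !![1, a; 0, 1] (MvPolynomial.X 0) = MvPolynomial.X 0 := by
    simp [linSubst]
  have h1 : linSubst K !![1, a; 0, 1] (MvPolynomial.X 1) =
      a • MvPolynomial.X 0 + MvPolynomial.X 1 := by
    simp [linSubst, MvPolynomial.smul_eq_C_mul]
  rw [h0, h1, add_pow, Finset.mul_sum, Finset.smul_sum]
  refine Finset.sum_congr rfl fun l hl => ?_
  have hl' : l ≤ j := Nat.lt_succ_iff.1 (Finset.mem_range.1 hl)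
  have hj : (j : ℕ) ≤ m := Nat.lt_succ_iff.1 j.2
  have e : m - (j - l) = (m - j) + l := by omega
  rw [e, smul_pow, smul_mul_assoc, smul_mul_assoc, mul_smul_comm, smul_smul, smul_smul,
    mul_comm _ ((Nat.choose _ _ : ℕ) : MvPolynomial (Fin 2) K), ← nsmul_eq_mul,
    ← Nat.cast_smul_eq_nsmul K, mul_smul_comm, smul_smul, pow_add, mul_assoc,
    Nat.cast_choose K hl']
  congr 1
  · have := Nat.cast_ne_zero (R := K).2 (j : ℕ).factorial_ne_zero
    field_simp
  · rw [mul_assoc]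

variable {k : ℕ} (d : Fin k → ℕ)

/-- The divided forms of the summands of `W(d_1) ⊕ ⋯ ⊕ W(d_k)`. -/
def formVector (x : Σ i : Fin k, Fin (d i + 1)) : FormSum K d :=
  DirectSum.lof K (Fin k) (fun i => MvPolynomial.homogeneousSubmodule (Fin 2) K (d i)) x.1
    (dividedForm K (d x.1) x.2)

theorem linearIndependent_formVector [CharZero K] : LinearIndependent K (formVector K d) :=
  linearIndependent_lof (fun i => dividedForm K (d i)) fun i => linearIndependent_dividedForm K (d i)

variable {K d} in
theorem formSumRep_formVector [CharZero K] {g : GL (Fin 2) K} {a : K}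
    (hg : (g : Matrix (Fin 2) (Fin 2) K) = !![1, a; 0, 1]) (i : Fin k) (j : Fin (d i + 1)) :
    formSumRep K d g (formVector K d ⟨i, j⟩) =
      ∑ l ∈ Finset.range (j + 1), (a ^ l / l.factorial) •
        formVector K d ⟨i, ⟨j - l, (Nat.sub_le _ _).trans_lt j.2⟩⟩ := by
  have h : formSumRep K d g (formVector K d ⟨i, j⟩) =
      DirectSum.lof K (Fin k) (fun i => MvPolynomial.homogeneousSubmodule (Fin 2) K (d i)) i
        (formRep K (d i) g (dividedForm K (d i) j)) :=
    DirectSum.lmap_lof _ _ _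
  rw [h, formRep_dividedForm K hg, map_sum]
  refine Finset.sum_congr rfl fun l _ => ?_
  rw [map_smul]
  rfl

end Forms

/-! ### Diagonal extensions, grading and Hilbert series. -/

section Homogeneous

variable {K : Type*} [Field K] {R : Type*} [Ring R] [Algebra K R] {n : ℕ}

/-- With components written as powers of `KY`, an algebra map that preserves `KY` visibly preserves
each degree. -/
theorem homogComponent_eq_pow (m : ℕ) : homogComponent K R n m = genSpan K R n ^ m := by
  rw [genSpan, Submodule.span_pow, homogComponent]
  congr 1
  ext x
  rw [Set.mem_pow]
  constructor
  · rintro ⟨w, rfl⟩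
    exact ⟨fun j => ⟨gen K R n (w j), w j, rfl⟩, rfl⟩
  · rintro ⟨f, rfl⟩
    choose w hw using fun j => (f j).2
    exact ⟨w, by simp [hw]⟩

theorem diagExt_mem_homogComponent (A : Module.End K (genSpan K R n)) {m : ℕ}
    {u : RelFreeAlg K R n} (hu : u ∈ homogComponent K R n m) :
    diagExt A u ∈ homogComponent K R n m := by
  rw [homogComponent_eq_pow] at hu ⊢
  have h : (genSpan K R n).map (diagExt A).toLinearMap ≤ genSpan K R n := by
    rintro _ ⟨v, hv, rfl⟩
    exact (diagExt_apply A ⟨v, hv⟩).symm ▸ (A ⟨v, hv⟩).2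
  have h2 := Submodule.mem_map_of_mem (f := (diagExt A).toLinearMap) hu
  rw [Submodule.map_pow] at h2
  exact pow_le_pow_left' h m h2

theorem diagExt_symm_apply (e : genSpan K R n ≃ₗ[K] genSpan K R n) (u : RelFreeAlg K R n) :
    diagExt e.symm.toLinearMap (diagExt e.toLinearMap u) = u := by
  have h : (diagExt e.symm.toLinearMap).comp (diagExt e.toLinearMap) = AlgHom.id K _ :=
    algHom_ext_gen fun i => by
      rw [AlgHom.comp_apply, diagExt_apply _ ⟨_, gen_mem i⟩, diagExt_apply]
      simp
  exact DFunLike.congr_fun h u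

/-- Subalgebras which correspond under the diagonal extension of an automorphism of `KY` have
the same Hilbert series. -/
theorem hilbertSeries_eq_of_diagExt (e : genSpan K R n ≃ₗ[K] genSpan K R n)
    {A B : Subalgebra K (RelFreeAlg K R n)}
    (h : ∀ u, u ∈ A ↔ diagExt e.toLinearMap u ∈ B) : hilbertSeries A = hilbertSeries B := by
  ext m
  rw [hilbertSeries, hilbertSeries, PowerSeries.coeff_mk, PowerSeries.coeff_mk]
  congr 1
  have h' (u) : diagExt e.toLinearMap (diagExt e.symm.toLinearMap u) = u :=
    diagExt_symm_apply e.symm u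
  let E : RelFreeAlg K R n ≃ₗ[K] RelFreeAlg K R n :=
    LinearEquiv.ofLinearMap (diagExt e.toLinearMap).toLinearMap
      (diagExt e.symm.toLinearMap).toLinearMap
      (LinearMap.ext h') (LinearMap.ext (diagExt_symm_apply e))
  refine (E.ofSubmodules _ _ ?_).finrank_eq
  ext u
  constructor
  · rintro ⟨v, ⟨hv, hv'⟩, rfl⟩
    exact ⟨(h v).1 hv, diagExt_mem_homogComponent _ hv'⟩
  · rintro ⟨hu, hu'⟩
    refine ⟨diagExt e.symm.toLinearMap u, ⟨(h _).2 ?_, diagExt_mem_homogComponent _ hu'⟩, h' u⟩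
    exact (h' u).symm ▸ hu

theorem algHom_ext_basis {ι : Type*} (b : Module.Basis ι K (genSpan K R n))
    {f g : RelFreeAlg K R n →ₐ[K] RelFreeAlg K R n}
    (h : ∀ i, f (b i) = g (b i)) : f = g := by
  have h' : f.toLinearMap ∘ₗ (genSpan K R n).subtype =
      g.toLinearMap ∘ₗ (genSpan K R n).subtype := b.ext h
  exact algHom_ext_gen fun i => DFunLike.congr_fun h' ⟨_, gen_mem i⟩

end Homogeneous

/-! ### The exponential of `δ` on Jordan cells and its conjugation to the unitriangular action. -/

section JordanCells

variable {K : Type*} [Field K] {R : Type*} [Ring R] [Algebra K R] {n : ℕ}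
  {δ : WeitzenbockDerivation K R n} {k : ℕ} {d : Fin k → ℕ}
  {b : Module.Basis (Σ i : Fin k, Fin (d i + 1)) K (genSpan K R n)}

theorem pow_apply_jordanBasis
    (hs : ∀ (i : Fin k) (j : Fin (d i)), δ.toLin (b ⟨i, j.succ⟩) = b ⟨i, j.castSucc⟩)
    (i : Fin k) (j : Fin (d i + 1)) {l : ℕ} (hl : l ≤ j) :
    (δ.toLin ^ l) (b ⟨i, j⟩) = b ⟨i, ⟨j - l, (Nat.sub_le _ _).trans_lt j.2⟩⟩ := by
  induction l with
  | zero => simp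
  | succ l ih =>
    rw [pow_succ', Module.End.mul_apply, ih (by omega)]
    have hj := j.2
    have h1 : (⟨j - l, (Nat.sub_le _ _).trans_lt j.2⟩ : Fin (d i + 1)) =
        (⟨j - (l + 1), by omega⟩ : Fin (d i)).succ := by
      apply Fin.ext
      simp only [Fin.val_succ]
      omega
    rw [h1, hs]
    rfl

theorem pow_succ_apply_jordanBasis (h0 : ∀ i, δ.toLin (b ⟨i, 0⟩) = 0)
    (hs : ∀ (i : Fin k) (j : Fin (d i)), δ.toLin (b ⟨i, j.succ⟩) = b ⟨i, j.castSucc⟩)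
    (i : Fin k) (j : Fin (d i + 1)) : (δ.toLin ^ ((j : ℕ) + 1)) (b ⟨i, j⟩) = 0 := by
  rw [pow_succ', Module.End.mul_apply, pow_apply_jordanBasis hs i j le_rfl]
  have h : (⟨j - j, (Nat.sub_le _ _).trans_lt j.2⟩ : Fin (d i + 1)) = 0 := by simp
  rw [h, h0]

theorem expAlgHom_apply_jordanBasis [CharZero K] (h0 : ∀ i, δ.toLin (b ⟨i, 0⟩) = 0)
    (hs : ∀ (i : Fin k) (j : Fin (d i)), δ.toLin (b ⟨i, j.succ⟩) = b ⟨i, j.castSucc⟩)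
    (a : K) (i : Fin k) (j : Fin (d i + 1)) :
    expAlgHom δ.toLin δ.leibniz δ.locallyNilpotent a (b ⟨i, j⟩) =
      ∑ l ∈ Finset.range (j + 1), (a ^ l / l.factorial) •
        (b ⟨i, ⟨j - l, (Nat.sub_le _ _).trans_lt j.2⟩⟩ : RelFreeAlg K R n) := by
  rw [expAlgHom_apply _ _ _ (pow_succ_apply_jordanBasis h0 hs i j)]
  refine Finset.sum_congr rfl fun l hl => ?_
  rw [pow_apply_jordanBasis hs i j (Nat.lt_succ_iff.1 (Finset.mem_range.1 hl))]

/-- A linear isomorphism of `KY` which carries a Jordan basis of `δ` to the divided forms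
intertwines `exp (a δ)` with the action of the unitriangular matrix with entry `a`. -/
theorem diagAction_diagExt [CharZero K] (h0 : ∀ i, δ.toLin (b ⟨i, 0⟩) = 0)
    (hs : ∀ (i : Fin k) (j : Fin (d i)), δ.toLin (b ⟨i, j.succ⟩) = b ⟨i, j.castSucc⟩)
    (φ : genSpan K R n ≃ₗ[K] FormSum K d) (e : genSpan K R n ≃ₗ[K] genSpan K R n)
    (he : ∀ x, e (b x) = φ.symm (formVector K d x)) {g : GL (Fin 2) K} {a : K}
    (hg : (g : Matrix (Fin 2) (Fin 2) K) = !![1, a; 0, 1]) (u : RelFreeAlg K R n) :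
    diagAction (transport φ (formSumRep K d)) g (diagExt e.toLinearMap u) =
      diagExt e.toLinearMap (expAlgHom δ.toLin δ.leibniz δ.locallyNilpotent a u) := by
  suffices h : (diagAction (transport φ (formSumRep K d)) g).comp (diagExt e.toLinearMap) =
      (diagExt e.toLinearMap).comp (expAlgHom δ.toLin δ.leibniz δ.locallyNilpotent a) from
    DFunLike.congr_fun h u
  -- Both sides are algebra maps, so the Jordan basis of `KY` suffices; there both give the same
  -- exponential sum.
  refine algHom_ext_basis b fun x => ?_
  obtain ⟨i, j⟩ := x
  have h1 (x) : diagExt e.toLinearMap (b x : RelFreeAlg K R n) =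
      (φ.symm (formVector K d x) : genSpan K R n) := by
    rw [diagExt_apply, LinearEquiv.coe_coe, he]
  have h2 (v : FormSum K d) : diagAction (transport φ (formSumRep K d)) g
      (φ.symm v : genSpan K R n) = (φ.symm (formSumRep K d g v) : genSpan K R n) := by
    refine (diagExt_apply _ _).trans (congrArg Subtype.val ?_)
    exact congrArg (fun v => φ.symm (formSumRep K d g v)) (φ.apply_symm_apply v)
  rw [AlgHom.comp_apply, AlgHom.comp_apply, expAlgHom_apply_jordanBasis h0 hs, map_sum, h1, h2,
    formSumRep_formVector hg, map_sum, AddSubmonoidClass.coe_finsetSum]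
  refine Finset.sum_congr rfl fun l _ => ?_
  rw [map_smul, map_smul, h1, Submodule.coe_smul]

end JordanCells

end RelFree

end

theorem mainTheorem7 (K : Type*) [Field K] [CharZero K] (R : Type*) [Ring R] [Algebra K R] (n : ℕ)
    (δ : RelFree.WeitzenbockDerivation K R n) (k : ℕ) (d : Fin k → ℕ)
    (hδ : δ.HasJordanCells d)
    (φ : RelFree.genSpan K R n ≃ₗ[K] RelFree.FormSum K d) :
    RelFree.hilbertSeries δ.constants =
      RelFree.hilbertSeries
        (RelFree.invariants
          (RelFree.diagAction (RelFree.transport φ (RelFree.formSumRep K d)))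
          (RelFree.UT2 K)) := by
  obtain ⟨b, h0, hs⟩ := hδ
  obtain ⟨e, he⟩ := RelFree.exists_equiv_apply_basis φ b
    (RelFree.linearIndependent_formVector K d)
  refine RelFree.hilbertSeries_eq_of_diagExt e fun u => ⟨fun hu g hg => ?_, fun hu => ?_⟩
  · obtain ⟨a, ha⟩ := hg
    rw [RelFree.diagAction_diagExt h0 hs φ e he ha,
      RelFree.expAlgHom_apply_of_apply_eq_zero _ _ _ hu]
  -- Invariance under the single matrix with entry `1` is enough for the converse.
  · let g : GL (Fin 2) K := Matrix.GeneralLinearGroup.mkOfDetNeZero !![1, 1; 0, 1] (by simp)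
    have hg : (g : Matrix (Fin 2) (Fin 2) K) = !![1, 1; 0, 1] := rfl
    have h1 := hu g ⟨1, hg⟩
    rw [RelFree.diagAction_diagExt h0 hs φ e he hg] at h1
    refine RelFree.apply_eq_zero_of_expAlgHom_one_apply δ.leibniz δ.locallyNilpotent ?_
    exact (Function.LeftInverse.injective (RelFree.diagExt_symm_apply e)) h1
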